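/- For families of functions $\omega\to\omega$, let $\mathfrak b$ be the least cardinality of a family that is unbounded with respect to eventual domination $\le^*$, and let $\mathfrak c=2^{\aleph_0}$. A *sequential cascade* is a tree $V$ with a least element $\emptyset_V$ and without infinite branches in which the set $v^+$ of immediate successors of each non-maximal $v$ is countably infinite. The rank of $v\in V$ is $r(v)=0$ if $v$ is maximal, and otherwise the least ordinal greater than $r(w)$ for all $w\in v^+$; the rank of $V$ is $r(V)=r(\emptyset_V)$. The cascade $V$ is *monotone* if each set $v^+$ can be ordered in type $\omega$ so that the ranks of its elements form a non-decreasing sequence. All cascades considered have their set $\max V$ of maximal elements contained in $\omega$. The *contour* $\int V$ is the filter on $\omega$ defined by recursion: if $V$ consists of the single element $k\in\omega$, then $\int V=\{U\subseteq\omega: k\in U\}$; otherwise, if $V_n$ ($n<\omega$) are the cascades above the immediate successors of $\emptyset_V$, then $U\in\int V$ if and only if $U\in\int V_n$ for all but finitely many $n$. A *monotone sequential contour of rank $\alpha$* is the contour of a monotone sequential cascade of rank $\alpha$. For an ordinal $\alpha$ with $1\le\alpha\le\omega_1$, the class $\mathcal P_\alpha$ of the P-hierarchy consists of all ultrafilters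 $u$ on $\omega$ such that for each $\beta$ with $1\le\beta<\alpha$ some monotone sequential contour of rank $\beta$ is contained in $u$, and no monotone sequential contour of rank $\alpha$ is contained in $u$. For ultrafilters on $\omega$ write $u\le_{RK}v$ if $u=\{A\subseteq\omega : f^{-1}(A)\in v\}$ for some $f:\omega\to\omega$; two ultrafilters are *Rudin–Keisler incomparable* if neither $u\le_{RK}v$ nor $v\le_{RK}u$. **Corollary 2.26.** Assume $\mathfrak b=\mathfrak c$. Then for every ordinal $\xi$ with $1<\xi\le\omega_1$, the class $\mathcal P_\xi$ contains a family of cardinality $\mathfrak b$ of pairwise Rudin–Keisler incomparable ultrafilters. -/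

import Mathlib

open Filter Set
open scoped Cardinal Ordinal

/-- A sequential cascade whose maximal elements are labelled by natural numbers. It is either a
single (maximal) element, or a root whose immediate successors form an `ω`-sequence and carry
the cascades `V 0, V 1, …` above them. Being an inductive type, it has no infinite branches.
For the cascades satisfying `SeqCascade.DistinctLabels` below, the labels identify the set
`max V` of maximal elements with a subset of `ω`. -/
inductive SeqCascade : Type
  | leaf (k : ℕ) : SeqCascade
  | node (V : ℕ → SeqCascade) : SeqCascade

namespace SeqCascade

/-- The set `max V` of maximal elements, seen as a set of natural numbers. -/
def maxSet : SeqCascade → Set ℕ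
  | leaf k => {k}
  | node V => ⋃ n, (V n).maxSet

/-- Different maximal elements carry different labels. -/
def DistinctLabels : SeqCascade → Prop
  | leaf _ => True
  | node V => (∀ n, (V n).DistinctLabels) ∧ Pairwise fun m n => Disjoint (V m).maxSet (V n).maxSet

/-- The rank: `0` for a maximal element, and otherwise the least ordinal greater than the ranks
of all immediate successors. -/
noncomputable def rank : SeqCascade → Ordinal.{0}
  | leaf _ => 0
  | node V => ⨆ n, Order.succ (V n).rank

/-- The cascade is monotone: at every non-maximal element, the ranks of the immediate successors
form a non-decreasing sequence (in the order of type `ω` with which they are given). -/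
def IsMonotone : SeqCascade → Prop
  | leaf _ => True
  | node V => (∀ n, (V n).IsMonotone) ∧ Monotone fun n => (V n).rank

/-- The contour `∫ V`, as a filter on `ω`: a set `U` belongs to the contour of `node V` if and
only if `U` belongs to the contour of `V n` for all but finitely many `n`. (`Filter.bind p u` is
the contour `⋃ P ∈ p, ⋂ s ∈ P, u s` of the filters `u s` along the filter `p`.) For a cascade of
rank `1` this is the filter generated by the cofinite subsets of `max V`. -/
def contour : SeqCascade → Filter ℕ
  | leaf k => pure k
  | node V => Filter.bind cofinite fun n => (V n).contour

end SeqCascade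

/-- `F` is a monotone sequential contour of rank `α` on `ω`. -/
def IsMonotoneSeqContour (α : Ordinal.{0}) (F : Filter ℕ) : Prop :=
  ∃ V : SeqCascade, V.DistinctLabels ∧ V.IsMonotone ∧ V.rank = α ∧ V.contour = F

/-- The class `𝒫_α` of the P-hierarchy: the ultrafilters on `ω` that contain a monotone
sequential contour of each rank `β` with `1 ≤ β < α`, but none of rank `α`. -/
def PClass (α : Ordinal.{0}) : Set (Ultrafilter ℕ) :=
  {u | (∀ β, 1 ≤ β → β < α → ∃ F, IsMonotoneSeqContour β F ∧ F.sets ⊆ (u : Filter ℕ).sets) ∧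
    ¬ ∃ F, IsMonotoneSeqContour α F ∧ F.sets ⊆ (u : Filter ℕ).sets}

/-- The Rudin–Keisler order: `u ≤_RK v` if `u` is the image of `v` under some map `ω → ω`. -/
def RKLE (u v : Ultrafilter ℕ) : Prop :=
  ∃ f : ℕ → ℕ, v.map f = u

/-- The bounding number `𝔟`: the least cardinality of a family of functions `ω → ω` that is
unbounded in the order of eventual domination. -/
noncomputable def boundingNumber : Cardinal.{0} :=
  sInf {κ | ∃ B : Set (ℕ → ℕ), #B = κ ∧ ¬ ∃ g : ℕ → ℕ, ∀ f ∈ B, ∀ᶠ n in atTop, f n ≤ g n}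

/-! ### Families of fewer than `𝔟` functions or sets -/

/-! Fix contours of cascades `chain α` of every countable rank α ≥ 1, growing with α as families of
sets, and let `baseFilter ξ` be the union of those of rank below ξ. An ultrafilter containing it has
all the contours that 𝒫_ξ requires. Filters indexed by the 𝔠 subsets of ω are enlarged
simultaneously by a recursion of length 𝔠. One kind of stage adds the complement of a member of a
contour of rank ξ; the other keeps a map f from carrying one ultrafilter to another. Before each
stage fewer than 𝔠 = 𝔟 sets have been added to each filter, so two facts suffice.

Such a filter contains no monotone contour of rank ξ (`exists_mem_contour_notMem`). For ξ < ω₁ it is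
a union of fewer than 𝔟 traces `V.contour ⊓ 𝓟 B` with V of smaller rank. Induction on the cascade of
rank ξ produces sets avoiding these traces: the sets found above the successors of the root are
amalgamated by one function dominating fewer than 𝔟 others. No cascade has rank ω₁.

Such a filter leaves some set undecided (`exists_notMem_compl_notMem`): this set is pulled back from
ω, where a single set splits fewer than 𝔟 infinite sets. -/

theorem exists_monotone_dominating {ι : Type} (hι : #ι < boundingNumber) (f : ι → ℕ → ℕ) :
    ∃ g : ℕ → ℕ, Monotone g ∧ ∀ i, ∀ᶠ n in atTop, f i n ≤ g n := by
  have h : ∃ g : ℕ → ℕ, ∀ f' ∈ range f, ∀ᶠ n in atTop, f' n ≤ g n := by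
    by_contra hcon
    have h1 : boundingNumber ≤ #(range f) := csInf_le' ⟨range f, rfl, hcon⟩
    exact absurd (h1.trans Cardinal.mk_range_le) (not_le.2 hι)
  obtain ⟨g, hg⟩ := h
  refine ⟨fun n => ∑ k ∈ Finset.range (n + 1), g k, fun a b hab => ?_, fun i => ?_⟩
  · exact Finset.sum_le_sum_of_subset (Finset.range_mono (by omega))
  · filter_upwards [hg _ ⟨i, rfl⟩] with n hn
    exact hn.trans (Finset.single_le_sum (f := g) (fun _ _ => Nat.zero_le _) (by simp))

/-- Let g dominate the functions sending n to a later element of `R i`, and cut ω at points with a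
(j + 1) > g (a j). Almost every interval then meets `R i`; A consists of the even intervals. -/
theorem exists_splitting {ι : Type} (hι : #ι < boundingNumber) (R : ι → Set ℕ)
    (hR : ∀ i, (R i).Infinite) :
    ∃ A : Set ℕ, ∀ i, (R i ∩ A).Infinite ∧ (R i \ A).Infinite := by
  have hnext : ∀ i n, ∃ x, x ∈ R i ∧ n < x := fun i n => by
    obtain ⟨x, hx, hnx⟩ := (hR i).exists_gt n
    exact ⟨x, hx, hnx⟩
  choose next hmem hlt using hnext
  obtain ⟨g, -, hg⟩ := exists_monotone_dominating hι next
  let a : ℕ → ℕ := fun j => Nat.rec 0 (fun _ x => g x + x + 1) j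
  have ha : ∀ j, a (j + 1) = g (a j) + a j + 1 := fun j => rfl
  have hmono : StrictMono a := strictMono_nat_of_lt_succ fun j => by rw [ha]; omega
  have key : ∀ i, ∃ N, ∀ j, N ≤ a j → ∃ x ∈ R i, a j ≤ x ∧ x < a (j + 1) := fun i => by
    obtain ⟨N, hN⟩ := eventually_atTop.1 (hg i)
    refine ⟨N, fun j hj => ⟨next i (a j), hmem _ _, (hlt _ _).le, ?_⟩⟩
    have := hN _ hj
    rw [ha]; omega
  refine ⟨{x | ∃ j, a (2 * j) ≤ x ∧ x < a (2 * j + 1)}, fun i => ?_⟩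
  obtain ⟨N, hN⟩ := key i
  constructor
  · refine Set.infinite_of_forall_exists_gt fun n => ?_
    have hle := hmono.id_le (2 * (N + n + 1))
    simp only [id] at hle
    obtain ⟨x, hx, h1, h2⟩ := hN (2 * (N + n + 1)) (by omega)
    exact ⟨x, ⟨hx, N + n + 1, h1, h2⟩, by omega⟩
  · refine Set.infinite_of_forall_exists_gt fun n => ?_
    have hle := hmono.id_le (2 * (N + n + 1) + 1)
    simp only [id] at hle
    obtain ⟨x, hx, h1, h2⟩ := hN (2 * (N + n + 1) + 1) (by omega)
    refine ⟨x, ⟨hx, ?_⟩, by omega⟩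
    rintro ⟨j, h3, h4⟩
    have h5 : 2 * (N + n + 1) + 1 < 2 * j + 1 := hmono.lt_iff_lt.1 (h1.trans_lt h4)
    have h6 : 2 * j < 2 * (N + n + 1) + 1 + 1 := hmono.lt_iff_lt.1 (h3.trans_lt h2)
    omega

theorem mk_finset_lt_continuum {ι : Type} (hι : #ι < 𝔠) : #(Finset ι) < 𝔠 := by
  rcases finite_or_infinite ι with h | h
  · exact (Cardinal.lt_aleph0_of_finite _).trans Cardinal.aleph0_lt_continuum
  · rwa [Cardinal.mk_finset_of_infinite]

namespace SeqCascade

/-! ### Contours and ranks -/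

theorem mem_contour_node {V : ℕ → SeqCascade} {U : Set ℕ} :
    U ∈ (node V).contour ↔ ∀ᶠ n in cofinite, U ∈ (V n).contour := Iff.rfl

theorem mem_contour_node_inf {V : ℕ → SeqCascade} {U B : Set ℕ} :
    U ∈ (node V).contour ⊓ 𝓟 B ↔ ∀ᶠ n in cofinite, U ∈ (V n).contour ⊓ 𝓟 B := by
  simp only [mem_inf_principal]
  rfl

theorem maxSet_mem_contour (V : SeqCascade) : V.maxSet ∈ V.contour := by
  induction V with
  | leaf k => simp [maxSet, contour]
  | node V ih =>
    exact mem_contour_node.2 (Eventually.of_forall fun n =>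
      mem_of_superset (ih n) (subset_iUnion (fun n => (V n).maxSet) n))

instance neBot_contour (V : SeqCascade) : V.contour.NeBot := by
  induction V with
  | leaf k => simp only [contour]; infer_instance
  | node V ih =>
    refine ⟨fun h => ?_⟩
    have h1 : ∅ ∈ (node V).contour := by rw [h]; trivial
    obtain ⟨n, hn⟩ := (mem_contour_node.1 h1).exists
    exact (ih n).ne (empty_mem_iff_bot.1 hn)

theorem rank_lt_rank_node (V : ℕ → SeqCascade) (n : ℕ) : (V n).rank < (node V).rank := by
  rw [← Order.succ_le_iff]
  exact Ordinal.le_iSup (fun n => Order.succ (V n).rank) n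

theorem exists_le_rank_of_lt {V : ℕ → SeqCascade} {α : Ordinal.{0}} (h : α < (node V).rank) :
    ∃ n, α ≤ (V n).rank := by
  obtain ⟨n, hn⟩ := Ordinal.lt_iSup_iff.1 h
  exact ⟨n, Order.lt_succ_iff.1 hn⟩

theorem rank_lt_omega_one (V : SeqCascade) : V.rank < ω₁ := by
  induction V with
  | leaf k => exact Ordinal.omega_pos 1
  | node V ih =>
    exact Ordinal.iSup_lt_omega_one fun n => (Cardinal.isSuccLimit_omega 1).succ_lt (ih n)

/-- A code for a cascade: the label of the maximal element reached by following a path. -/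
def code : SeqCascade → List ℕ → Option ℕ
  | leaf k, _ => some k
  | node _, [] => none
  | node V, n :: l => (V n).code l

theorem code_injective : Function.Injective code := by
  intro V
  induction V with
  | leaf k =>
    intro W h
    cases W with
    | leaf j => have := congrFun h []; simp_all [code]
    | node W => have := congrFun h []; simp_all [code]
  | node V ih =>
    intro W h
    cases W with
    | leaf j => have := congrFun h []; simp_all [code]
    | node W =>
      congr 1
      funext n
      exact ih n (funext fun l => by simpa [code] using congrFun h (n :: l))

/-- This bounds the number of stages of the transfinite construction. -/
theorem mk_le_continuum : #SeqCascade ≤ 𝔠 := by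
  refine (Cardinal.mk_le_of_injective code_injective).trans ?_
  simp

/-! ### Relabelling -/

/-- Apply `f` to all labels of a cascade. -/
def relabel (f : ℕ → ℕ) : SeqCascade → SeqCascade
  | leaf k => leaf (f k)
  | node V => node fun n => (V n).relabel f

theorem rank_relabel (f : ℕ → ℕ) (V : SeqCascade) : (V.relabel f).rank = V.rank := by
  induction V with
  | leaf k => rfl
  | node V ih => simp only [relabel, rank, ih]

theorem maxSet_relabel (f : ℕ → ℕ) (V : SeqCascade) : (V.relabel f).maxSet = f '' V.maxSet := by
  induction V with
  | leaf k => simp [relabel, maxSet]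
  | node V ih => simp only [relabel, maxSet, ih, image_iUnion]

theorem IsMonotone.relabel {f : ℕ → ℕ} {V : SeqCascade} (hV : V.IsMonotone) :
    (V.relabel f).IsMonotone := by
  induction V with
  | leaf k => trivial
  | node V ih =>
    refine ⟨fun n => ih n (hV.1 n), ?_⟩
    simpa only [rank_relabel] using hV.2

theorem DistinctLabels.relabel {f : ℕ → ℕ} (hf : f.Injective) {V : SeqCascade}
    (hV : V.DistinctLabels) : (V.relabel f).DistinctLabels := by
  induction V with
  | leaf k => trivial
  | node V ih =>
    refine ⟨fun n => ih n (hV.1 n), fun m n hmn => ?_⟩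
    simp only [maxSet_relabel]
    exact (disjoint_image_iff hf).2 (hV.2 hmn)

theorem contour_relabel (f : ℕ → ℕ) (V : SeqCascade) :
    (V.relabel f).contour = map f V.contour := by
  induction V with
  | leaf k => simp [SeqCascade.relabel, contour]
  | node V ih =>
    ext U
    simp only [SeqCascade.relabel, mem_contour_node, ih, mem_map]

end SeqCascade

/-! ### Avoiding fewer than 𝔟 traces of smaller rank -/

namespace SeqCascade

/-- A set of cascades with traces is closed under passing to subcascades. -/
def SubClosed (S : Set (SeqCascade × Set ℕ)) : Prop :=
  ∀ V B, (node V, B) ∈ S → ∀ m, (V m, B) ∈ S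

theorem SubClosed.image {S : Set (SeqCascade × Set ℕ)} (hc : SubClosed S) (X : Set ℕ) :
    SubClosed ((fun P => (P.1, P.2 ∩ X)) '' S) := by
  rintro V B ⟨⟨V', B'⟩, hP, heq⟩ m
  simp only [Prod.mk.injEq] at heq
  obtain ⟨rfl, rfl⟩ := heq
  exact ⟨(V m, B'), hc _ _ hP m, rfl⟩

theorem compl_biUnion_maxSet_mem_contour {W : ℕ → SeqCascade} (hd : (node W).DistinctLabels)
    (k : ℕ) : (⋃ i ∈ Iio k, (W i).maxSet)ᶜ ∈ (node W).contour := by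
  rw [mem_contour_node, Nat.cofinite_eq_atTop]
  filter_upwards [eventually_ge_atTop k] with n hn
  refine mem_of_superset (maxSet_mem_contour (W n)) fun x hx => ?_
  simp only [mem_compl_iff, mem_iUnion, mem_Iio, not_exists]
  intro i hi hxi
  exact disjoint_left.1 (hd.2 (show i ≠ n by omega)) hxi hx

/-- The decreasing sequence `U` of sets escapes all traces of small rank in `S`. -/
def Escapes (S : Set (SeqCascade × Set ℕ)) (α : Ordinal.{0}) (U : ℕ → Set ℕ) : Prop :=
  ∀ V B, (V, B) ∈ S → V.rank < α → (V.contour ⊓ 𝓟 B).NeBot → ∃ k, U k ∉ V.contour ⊓ 𝓟 B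

theorem inter_mem_inf_principal {F : Filter ℕ} {U X B : Set ℕ} (h : U ∈ F ⊓ 𝓟 B) :
    U ∩ X ∈ F ⊓ 𝓟 (B ∩ X) := by
  rw [mem_inf_principal] at h ⊢
  exact mem_of_superset h fun x hx hb => ⟨hx hb.1, hb.2⟩

/-- Otherwise the trace contains the complements of the finitely many `X i` with k ≤ i < l, and
intersecting with these reduces the first l sets to the first k. -/
theorem exists_trace_neBot {F : Filter ℕ} {X : ℕ → Set ℕ} {B : Set ℕ} {k l : ℕ}
    (hl : ⋃ i ∈ Iio l, X i ∈ F ⊓ 𝓟 B) (hk : ⋃ i ∈ Iio k, X i ∉ F ⊓ 𝓟 B) :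
    ∃ n, k ≤ n ∧ (F ⊓ 𝓟 (B ∩ X n)).NeBot := by
  by_contra hcon
  push Not at hcon
  refine hk ?_
  have h : ⋂ i ∈ Ico k l, (X i)ᶜ ∈ F ⊓ 𝓟 B := by
    refine (biInter_mem (finite_Ico k l)).2 fun i hi => ?_
    have h1 : ∅ ∈ F ⊓ 𝓟 (B ∩ X i) := by
      have := hcon i hi.1
      rw [this]; trivial
    rw [mem_inf_principal] at h1 ⊢
    exact mem_of_superset h1 fun x hx hb hX => hx ⟨hb, hX⟩
  refine mem_of_superset (inter_mem hl h) fun x hx => ?_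
  obtain ⟨h1, h2⟩ := hx
  simp only [mem_iUnion, mem_iInter, mem_Iio, mem_Ico, mem_compl_iff] at h1 h2 ⊢
  obtain ⟨i, hi, hxi⟩ := h1
  exact ⟨i, by_contra fun h => h2 i ⟨by omega, hi⟩ hxi, hxi⟩

/-- If all the cascades above the root of `node W` have escaping sequences, then there is one set
in the contour of `node W` that is in no trace of small rank, unless this trace lives on finitely
many of these cascades. -/
theorem exists_mem_contour_forall_notMem {W : ℕ → SeqCascade}
    (hd : (node W).DistinctLabels) (hm : (node W).IsMonotone)
    {S : Set (SeqCascade × Set ℕ)} (hS : #S < boundingNumber) (hc : SubClosed S)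
    {U : ℕ → ℕ → Set ℕ} (hanti : ∀ n, Antitone (U n)) (hU : ∀ n k, U n k ∈ (W n).contour)
    (hesc : ∀ n, Escapes ((fun P => (P.1, P.2 ∩ (W n).maxSet)) '' S) (W n).rank (U n)) :
    ∃ D ∈ (node W).contour,
      ∀ V B, (V, B) ∈ S → V.rank < (node W).rank →
        (∀ k, ⋃ i ∈ Iio k, (W i).maxSet ∉ V.contour ⊓ 𝓟 B) → D ∉ V.contour ⊓ 𝓟 B := by
  -- For a trace of `node V`, `h k` is an index at which `U n` escapes the trace of `V m`, for one
  -- suitable pair m, n ≥ k.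
  have hh : ∀ P : S, ∃ h : ℕ → ℕ, ∀ V, P.1.1 = node V → ∀ k,
      (∃ m ≥ k, ∃ n ≥ k, (V m).rank < (W n).rank ∧
        ((V m).contour ⊓ 𝓟 (P.1.2 ∩ (W n).maxSet)).NeBot) →
      ∃ m ≥ k, ∃ n ≥ k, U n (h k) ∉ (V m).contour ⊓ 𝓟 (P.1.2 ∩ (W n).maxSet) := by
    rintro ⟨⟨V, B⟩, hP⟩
    cases V with
    | leaf x => exact ⟨0, fun V hV => by simp at hV⟩
    | node V =>
      have : ∀ k, ∃ j, (∃ m ≥ k, ∃ n ≥ k, (V m).rank < (W n).rank ∧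
          ((V m).contour ⊓ 𝓟 (B ∩ (W n).maxSet)).NeBot) →
          ∃ m ≥ k, ∃ n ≥ k, U n j ∉ (V m).contour ⊓ 𝓟 (B ∩ (W n).maxSet) := by
        intro k
        by_cases h : ∃ m ≥ k, ∃ n ≥ k, (V m).rank < (W n).rank ∧
          ((V m).contour ⊓ 𝓟 (B ∩ (W n).maxSet)).NeBot
        · obtain ⟨m, hmk, n, hnk, hr, hne⟩ := h
          obtain ⟨j, hj⟩ := hesc n (V m) (B ∩ (W n).maxSet) ⟨(V m, B), hc _ _ hP m, rfl⟩ hr hne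
          exact ⟨j, fun _ => ⟨m, hmk, n, hnk, hj⟩⟩
        · exact ⟨0, fun h' => absurd h' h⟩
      choose h hh using this
      refine ⟨h, fun V' hV' => ?_⟩
      cases hV'
      exact hh
  choose h hh using hh
  obtain ⟨g, hg, hdom⟩ := exists_monotone_dominating hS h
  refine ⟨⋃ n, U n (g n) ∩ (W n).maxSet, ?_, ?_⟩
  · exact mem_contour_node.2 (Eventually.of_forall fun n =>
      mem_of_superset (inter_mem (hU n _) (maxSet_mem_contour _))
        (subset_iUnion (fun n => U n (g n) ∩ (W n).maxSet) n))
  intro V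
  induction V with
  | leaf x =>
    intro B _ _ hX hD
    simp only [contour, mem_inf_principal, mem_pure, mem_ofPred_eq] at hX hD
    push Not at hX
    obtain ⟨n, -, hn⟩ := mem_iUnion.1 (hD (hX 0).1)
    exact (hX (n + 1)).2 (mem_biUnion (mem_Iio.2 n.lt_succ_self) hn)
  | node V ih =>
    intro B hB hr hX hD
    -- If infinitely many `V m` do not live on finitely many `W i`, the induction hypothesis applies
    -- to one of them.
    by_cases hfreq : ∃ᶠ m in cofinite, ∀ k, ⋃ i ∈ Iio k, (W i).maxSet ∉ (V m).contour ⊓ 𝓟 B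
    · obtain ⟨m, hm1, hm2⟩ := (hfreq.and_eventually (mem_contour_node_inf.1 hD)).exists
      exact ih m B (hc _ _ hB m) ((rank_lt_rank_node V m).trans hr) hm1 hm2
    · rw [not_frequently] at hfreq
      push Not at hfreq
      obtain ⟨n₀, hn₀⟩ := exists_le_rank_of_lt hr
      -- Almost every `V m` lives on finitely many `W i`, but no bound serves almost all m; so m and
      -- n can both be large. Monotonicity of W enters here: rank V m < rank V ≤ rank W n₀ ≤ rank W
      -- n.
      have hpair : ∀ k, ∃ m ≥ k, ∃ n ≥ k, (V m).rank < (W n).rank ∧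
          ((V m).contour ⊓ 𝓟 (B ∩ (W n).maxSet)).NeBot := by
        intro k
        have h1 := hX (max k n₀)
        rw [mem_contour_node_inf, not_eventually] at h1
        have h2 : ∀ᶠ m in cofinite, k ≤ m := by
          rw [Nat.cofinite_eq_atTop]; exact eventually_ge_atTop k
        obtain ⟨m, hm1, ⟨l, hl⟩, hkm⟩ := (h1.and_eventually (hfreq.and h2)).exists
        obtain ⟨n, hn, hne⟩ := exists_trace_neBot hl hm1
        refine ⟨m, hkm, n, (le_max_left _ _).trans hn, ?_, hne⟩
        exact (rank_lt_rank_node V m).trans_le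
          (hn₀.trans (hm.2 ((le_max_right _ _).trans hn)))
      rw [mem_contour_node_inf, Nat.cofinite_eq_atTop, eventually_atTop] at hD
      obtain ⟨N, hN⟩ := hD
      obtain ⟨N', hN'⟩ := eventually_atTop.1 (hdom ⟨_, hB⟩)
      obtain ⟨m, hmk, n, hnk, hmem⟩ := hh ⟨_, hB⟩ V rfl (max N N') (hpair _)
      refine hmem ?_
      -- Inside max W n the set D lies in U n (g n), and g n ≥ g k ≥ h k for k = max N N'.
      refine mem_of_superset (inter_mem_inf_principal (X := (W n).maxSet)
        (hN m ((le_max_left _ _).trans hmk))) ?_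
      rintro x ⟨hx, hxn⟩
      obtain ⟨n', hx1, hx2⟩ := mem_iUnion.1 hx
      have : n' = n := by
        by_contra hne
        exact disjoint_left.1 (hd.2 hne) hx2 hxn
      subst this
      exact hanti _ ((hN' _ (le_max_right _ _)).trans (hg hnk)) hx1

/-- One set does not suffice: a trace living on the first k cascades is escaped by removing these,
and k depends on the trace. That the sequence decreases is what lets domination amalgamate such
sequences one level up. -/
theorem exists_antitone_escapes (W : SeqCascade) (hd : W.DistinctLabels) (hm : W.IsMonotone)
    (S : Set (SeqCascade × Set ℕ)) (hS : #S < boundingNumber) (hc : SubClosed S) :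
    ∃ U : ℕ → Set ℕ, Antitone U ∧ (∀ k, U k ∈ W.contour) ∧ Escapes S W.rank U := by
  induction W generalizing S with
  | leaf x =>
    exact ⟨fun _ => univ, antitone_const, fun _ => univ_mem, fun V B _ h => by simp [rank] at h⟩
  | node W ih =>
    have := fun n => ih n (hd.1 n) (hm.1 n) ((fun P => (P.1, P.2 ∩ (W n).maxSet)) '' S)
      (Cardinal.mk_image_le.trans_lt hS) (hc.image _)
    choose U hanti hU hesc using this
    obtain ⟨D, hD, hmain⟩ := exists_mem_contour_forall_notMem hd hm hS hc hanti hU hesc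
    refine ⟨fun k => D \ ⋃ i ∈ Iio k, (W i).maxSet, fun a b hab => ?_, fun k => ?_, ?_⟩
    · exact sdiff_subset_sdiff_right (biUnion_subset_biUnion_left (Iio_subset_Iio hab))
    · exact inter_mem hD (compl_biUnion_maxSet_mem_contour hd k)
    · intro V B hV hr hne
      by_cases hX : ∀ k, ⋃ i ∈ Iio k, (W i).maxSet ∉ V.contour ⊓ 𝓟 B
      · exact ⟨0, fun h => hmain V B hV hr hX (mem_of_superset h sdiff_subset)⟩
      · push Not at hX
        obtain ⟨k, hk⟩ := hX
        refine ⟨k, fun h => ?_⟩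
        obtain ⟨x, hx1, hx2⟩ := (V.contour ⊓ 𝓟 B).nonempty_of_mem (inter_mem h hk)
        exact hx1.2 hx2

/-- A filter that is a union of fewer than `𝔟` traces of contours of rank smaller than that of
`W` does not contain the contour of `W`. -/
theorem exists_mem_contour_notMem {W : SeqCascade} (hd : W.DistinctLabels) (hm : W.IsMonotone)
    {S : Set (SeqCascade × Set ℕ)} (hS : #S < boundingNumber) (hc : SubClosed S)
    {T : Set (SeqCascade × Set ℕ)} (hTS : T ⊆ S) (hr : ∀ P ∈ T, P.1.rank < W.rank)
    {H : Filter ℕ} [H.NeBot] (hH : ∀ U, U ∈ H ↔ ∃ P ∈ T, U ∈ P.1.contour ⊓ 𝓟 P.2) :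
    ∃ U ∈ W.contour, U ∉ H := by
  cases W with
  | leaf x =>
    obtain ⟨P, hP, -⟩ := (hH univ).1 univ_mem
    exact absurd (hr P hP) (by simp [rank])
  | node W =>
    -- For the single filter H one k serves all traces; if there is none, no trace in T lives on
    -- finitely many `W i` and D alone works.
    by_cases hX : ∃ k, ⋃ i ∈ Iio k, (W i).maxSet ∈ H
    · obtain ⟨k, hk⟩ := hX
      exact ⟨_, compl_biUnion_maxSet_mem_contour hd k, compl_notMem hk⟩
    · push Not at hX
      choose U hanti hU hesc using fun n => exists_antitone_escapes (W n) (hd.1 n) (hm.1 n)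
        ((fun P => (P.1, P.2 ∩ (W n).maxSet)) '' S) (Cardinal.mk_image_le.trans_lt hS) (hc.image _)
      obtain ⟨D, hD, hmain⟩ := exists_mem_contour_forall_notMem hd hm hS hc hanti hU hesc
      refine ⟨D, hD, fun h => ?_⟩
      obtain ⟨P, hP, hDP⟩ := (hH D).1 h
      exact hmain P.1 P.2 (hTS hP) (hr P hP) (fun k hk => hX k ((hH _).2 ⟨P, hP, hk⟩)) hDP

end SeqCascade

/-! ### An increasing chain of contours -/

theorem countable_Iio_of_lt_omega_one {α : Ordinal.{0}} (h : α < ω₁) : (Iio α).Countable := by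
  rw [← Cardinal.le_aleph0_iff_set_countable, Cardinal.mk_Iio_ordinal, Cardinal.lift_le_aleph0]
  rw [← Cardinal.ord_aleph, Cardinal.lt_ord] at h
  rw [← Cardinal.succ_aleph0] at h
  exact Order.lt_succ_iff.1 h

theorem exists_range_eq_Ico {β α : Ordinal.{0}} (h : β < α) (hα : α < ω₁) :
    ∃ e : ℕ → Ordinal.{0}, range e = Ico β α := by
  obtain ⟨e, he⟩ := ((countable_Iio_of_lt_omega_one hα).mono
    (fun x hx => hx.2 : Ico β α ⊆ Iio α)).exists_eq_range ⟨β, le_rfl, h⟩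
  exact ⟨e, he.symm⟩

theorem exists_monotone_cofinal {α : Ordinal.{0}} (h : 1 < α) (hα : α < ω₁) :
    ∃ s : ℕ → Ordinal.{0}, Monotone s ∧ (∀ n, s n ∈ Ico 1 α) ∧ ∀ γ < α, ∃ n, γ ≤ s n := by
  obtain ⟨e, he⟩ := exists_range_eq_Ico h hα
  have hmem : ∀ n, e n ∈ Ico 1 α := fun n => he ▸ mem_range_self n
  let s : ℕ → Ordinal.{0} := fun n => Nat.rec (e 0) (fun n x => max x (e (n + 1))) n
  have hs : ∀ n, s (n + 1) = max (s n) (e (n + 1)) := fun n => rfl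
  have hle : ∀ n, e n ≤ s n := by
    rintro (_ | n)
    · exact le_rfl
    · exact le_max_right _ _
  refine ⟨s, monotone_nat_of_le_succ fun n => le_max_left _ _, fun n => ?_, fun γ hγ => ?_⟩
  · induction n with
    | zero => exact hmem 0
    | succ n ih =>
      rw [hs]
      exact ⟨ih.1.trans (le_max_left _ _), max_lt ih.2 (hmem _).2⟩
  · rcases le_total γ 1 with h1 | h1
    · exact ⟨0, h1.trans (hmem 0).1⟩
    · obtain ⟨n, hn⟩ : γ ∈ range e := he ▸ ⟨h1, hγ⟩
      exact ⟨n, hn ▸ hle n⟩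

open Classical in
/-- A non-decreasing sequence of ordinals in `[1, α)` that is cofinal in `α`. -/
noncomputable def ladder (α : Ordinal.{0}) : ℕ → Ordinal.{0} :=
  if h : 1 < α ∧ α < ω₁ then (exists_monotone_cofinal h.1 h.2).choose else 0

theorem ladder_spec {α : Ordinal.{0}} (h : 1 < α) (hα : α < ω₁) :
    Monotone (ladder α) ∧ (∀ n, ladder α n ∈ Ico 1 α) ∧ ∀ γ < α, ∃ n, γ ≤ ladder α n := by
  rw [ladder, dif_pos ⟨h, hα⟩]
  exact (exists_monotone_cofinal h hα).choose_spec

namespace SeqCascade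

open Classical in
/-- The cascades of an increasing chain of contours, indexed by the countable ordinals. -/
noncomputable def chain (α : Ordinal.{0}) : SeqCascade :=
  if 1 < α then
    -- The test is there for termination; `leaf 0` does not occur when 1 < α < ω₁.
    node fun n => if _h : ladder α n < α then (chain (ladder α n)).relabel (Nat.pair n) else leaf 0
  else node leaf
termination_by α

theorem chain_one : chain 1 = node leaf := by
  rw [chain, if_neg (lt_irrefl _)]

theorem chain_of_one_lt {α : Ordinal.{0}} (h : 1 < α) (hα : α < ω₁) :
    chain α = node fun n => (chain (ladder α n)).relabel (Nat.pair n) := by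
  rw [chain, if_pos h]
  congr 1
  funext n
  rw [dif_pos ((ladder_spec h hα).2.1 n).2]

theorem pair_injective (n : ℕ) : Function.Injective (Nat.pair n) := fun _ _ h =>
  (Nat.pair_eq_pair.1 h).2

theorem chain_spec {α : Ordinal.{0}} (h : 1 ≤ α) (hα : α < ω₁) :
    (chain α).DistinctLabels ∧ (chain α).IsMonotone ∧ (chain α).rank = α ∧
      (chain α).contour ≤ cofinite := by
  induction α using WellFoundedLT.induction with
  | ind α ih =>
  rcases h.eq_or_lt with rfl | h
  · rw [chain_one]
    refine ⟨⟨fun _ => trivial, fun m n hmn => ?_⟩, ⟨fun _ => trivial, fun _ _ _ => le_rfl⟩, ?_, ?_⟩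
    · simpa [maxSet] using hmn
    · simp [rank]
    · exact fun U hU => hU
  · obtain ⟨hmono, hmem, hcof⟩ := ladder_spec h hα
    rw [chain_of_one_lt h hα]
    have ih' := fun n => ih _ (hmem n).2 (hmem n).1 ((hmem n).2.trans hα)
    refine ⟨⟨fun n => (ih' n).1.relabel (pair_injective n), fun m n hmn => ?_⟩,
      ⟨fun n => (ih' n).2.1.relabel, ?_⟩, ?_, ?_⟩
    · simp only [maxSet_relabel]
      refine disjoint_left.2 ?_
      rintro _ ⟨x, -, rfl⟩ ⟨y, -, hxy⟩
      exact hmn (Nat.pair_eq_pair.1 hxy).1.symm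
    · simpa only [rank_relabel, (ih' _).2.2.1] using hmono
    · simp only [rank, rank_relabel, (ih' _).2.2.1]
      refine le_antisymm (Ordinal.iSup_le fun n => Order.succ_le_of_lt (hmem n).2) ?_
      refine le_of_forall_lt fun γ hγ => ?_
      obtain ⟨n, hn⟩ := hcof γ hγ
      exact Ordinal.lt_iSup_iff.2 ⟨n, Order.lt_succ_iff.2 hn⟩
    · refine fun U hU => mem_contour_node.2 (Eventually.of_forall fun n => ?_)
      rw [contour_relabel]
      exact (pair_injective n).tendsto_cofinite.mono_left (ih' n).2.2.2 hU

theorem contour_chain_of_one_lt {α : Ordinal.{0}} (h : 1 < α) (hα : α < ω₁) :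
    (chain α).contour =
      Filter.bind cofinite fun n => map (Nat.pair n) (chain (ladder α n)).contour := by
  rw [chain_of_one_lt h hα]
  simp only [contour, contour_relabel]

/-- For 1 < α < β the ladder of β is eventually at least α, hence above the ladder of α, and the
contours compare column by column. -/
theorem contour_chain_anti {α β : Ordinal.{0}} (h : 1 ≤ α) (hαβ : α ≤ β) (hβ : β < ω₁) :
    (chain β).contour ≤ (chain α).contour := by
  induction β using WellFoundedLT.induction generalizing α with
  | ind β ih =>
  rcases hαβ.eq_or_lt with rfl | hlt
  · exact le_rfl
  rcases h.eq_or_lt with rfl | h1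
  · rw [chain_one]
    exact (chain_spec hαβ hβ).2.2.2
  · rw [contour_chain_of_one_lt h1 (hlt.trans hβ), contour_chain_of_one_lt (h1.trans hlt) hβ]
    obtain ⟨-, hmem, -⟩ := ladder_spec h1 (hlt.trans hβ)
    obtain ⟨hmono, hmem', hcof⟩ := ladder_spec (h1.trans hlt) hβ
    obtain ⟨N, hN⟩ := hcof α hlt
    intro U hU
    change ∀ᶠ n in cofinite, _ at hU
    change ∀ᶠ n in cofinite, _
    have hge : ∀ᶠ n in cofinite, N ≤ n := by
      rw [Nat.cofinite_eq_atTop]; exact eventually_ge_atTop N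
    filter_upwards [hU, hge] with n hn hNn
    exact ih _ (hmem' n).2 (hmem n).1 ((hmem n).2.le.trans (hN.trans (hmono hNn)))
      ((hmem' n).2.trans hβ) hn

/-- The subcascade reached by following a path. -/
def sub : SeqCascade → List ℕ → SeqCascade
  | V, [] => V
  | leaf k, _ :: _ => leaf k
  | node V, n :: l => (V n).sub l

theorem sub_concat {V : SeqCascade} {l : List ℕ} {W : ℕ → SeqCascade} (h : V.sub l = node W)
    (m : ℕ) : V.sub (l ++ [m]) = W m := by
  induction l generalizing V with
  | nil =>
    simp only [sub] at h
    subst h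
    simp [sub]
  | cons n l ih =>
    cases V with
    | leaf k => simp [sub] at h
    | node V => exact ih h

end SeqCascade

open SeqCascade

/-! ### The base filter -/

/-- The union of the contours in the chain of rank less than `ξ`. -/
noncomputable def baseFilter (ξ : Ordinal.{0}) : Filter ℕ :=
  ⨅ α ∈ Ico 1 ξ, (chain α).contour

theorem mem_baseFilter {ξ : Ordinal.{0}} (h1 : 1 < ξ) (h2 : ξ ≤ ω₁) {U : Set ℕ} :
    U ∈ baseFilter ξ ↔ ∃ α ∈ Ico 1 ξ, U ∈ (chain α).contour := by
  have hne : (Ico 1 ξ).Nonempty := ⟨1, le_rfl, h1⟩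
  refine mem_biInf_of_directed (fun α hα β hβ => ?_) hne
  exact ⟨max α β, ⟨hα.1.trans (le_max_left _ _), max_lt hα.2 hβ.2⟩,
    contour_chain_anti hα.1 (le_max_left _ _) ((max_lt hα.2 hβ.2).trans_le h2),
    contour_chain_anti hβ.1 (le_max_right _ _) ((max_lt hα.2 hβ.2).trans_le h2)⟩

theorem baseFilter_le {ξ α : Ordinal.{0}} (h1 : 1 ≤ α) (h2 : α < ξ) :
    baseFilter ξ ≤ (chain α).contour :=
  biInf_le _ ⟨h1, h2⟩

theorem neBot_baseFilter {ξ : Ordinal.{0}} (h1 : 1 < ξ) (h2 : ξ ≤ ω₁) : (baseFilter ξ).NeBot := by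
  refine ⟨fun h => ?_⟩
  obtain ⟨α, -, hα⟩ := (mem_baseFilter h1 h2).1 (empty_mem_iff_bot.2 h)
  exact (neBot_contour (chain α)).ne (empty_mem_iff_bot.1 hα)

/-- This presents the filter as a union of traces counted by finite subsets of 𝓑. -/
theorem mem_inf_generate {F : Filter ℕ} {𝓑 : Set (Set ℕ)} {U : Set ℕ} :
    U ∈ F ⊓ generate 𝓑 ↔ ∃ G : Finset 𝓑, U ∈ F ⊓ 𝓟 (⋂ s ∈ G, (s : Set ℕ)) := by
  constructor
  · rintro ⟨Y, hY, Z, hZ, rfl⟩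
    obtain ⟨t, ht, hfin, hsub⟩ := mem_generate_iff.1 hZ
    obtain ⟨t, rfl⟩ : ∃ G : Finset 𝓑, (Subtype.val '' (G : Set 𝓑)) = t := by
      refine ⟨(hfin.preimage Subtype.val_injective.injOn).toFinset, ?_⟩
      rw [Finite.coe_toFinset, Subtype.image_preimage_coe, inter_eq_right.2 ht]
    refine ⟨t, inter_mem_inf hY (mem_principal.2 ?_)⟩
    refine Subset.trans (fun x hx => ?_) hsub
    rintro _ ⟨s, hs, rfl⟩
    exact mem_iInter₂.1 hx s hs
  · rintro ⟨G, hG⟩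
    refine inf_le_inf_left F (le_principal_iff.2 ?_) hG
    exact (biInter_finset_mem G).2 fun s _ => mem_generate_of_mem s.2

/-! ### Undecided sets -/

/-- Let R i be the set of n such that `B i` meets every member of `Φ i n`; it is infinite because
the i-th trace is proper. If C omits infinitely many points of R i, then p⁻¹ C is not in that trace.
So the preimage of a set splitting every R i is undecided. -/
theorem exists_notMem_compl_notMem {ι : Type} (hι : #ι < boundingNumber) {p : ℕ → ℕ}
    {Φ : ι → ℕ → Filter ℕ} (hp : ∀ i n, p ⁻¹' {n} ∈ Φ i n) {B : ι → Set ℕ} {H : Filter ℕ}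
    (hne : ∀ i, (Filter.bind cofinite (Φ i) ⊓ 𝓟 (B i)).NeBot)
    (hH : ∀ U ∈ H, ∃ i, U ∈ Filter.bind cofinite (Φ i) ⊓ 𝓟 (B i)) :
    ∃ A, A ∉ H ∧ Aᶜ ∉ H := by
  obtain ⟨A, hA⟩ := exists_splitting hι (fun i => {n | (B i)ᶜ ∉ Φ i n}) (by
    intro i hfin
    refine (hne i).ne (empty_mem_iff_bot.1 ?_)
    rw [mem_inf_principal]
    change ∀ᶠ n in cofinite, _
    filter_upwards [hfin.eventually_cofinite_notMem] with n hn
    exact not_not.1 hn)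
  have key : ∀ (C : Set ℕ) i, ({n | (B i)ᶜ ∉ Φ i n} \ C).Infinite →
      p ⁻¹' C ∉ Filter.bind cofinite (Φ i) ⊓ 𝓟 (B i) := by
    intro C i hC hmem
    rw [mem_inf_principal] at hmem
    change ∀ᶠ n in cofinite, _ at hmem
    obtain ⟨n, ⟨hn1, hn2⟩, hn3⟩ :=
      (hC.frequently_cofinite.and_eventually hmem).exists
    refine hn1 (mem_of_superset (inter_mem hn3 (hp i n)) ?_)
    rintro x ⟨hx1, hx2⟩ hxB
    have := hx1 hxB
    simp only [mem_preimage, mem_singleton_iff] at this hx2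
    exact hn2 (hx2 ▸ this)
  refine ⟨p ⁻¹' A, fun h => ?_, fun h => ?_⟩
  · obtain ⟨i, hi⟩ := hH _ h
    exact key A i (hA i).2 hi
  · obtain ⟨i, hi⟩ := hH _ h
    rw [← preimage_compl] at hi
    refine key Aᶜ i ?_ hi
    rw [sdiff_compl]
    exact (hA i).1

/-! ### The two properties of the base filter -/

theorem card_index_lt (hbc : boundingNumber = 𝔠) {𝓑 : Set (Set ℕ)} (h𝓑 : #𝓑 < 𝔠) (κ : Type)
    [Countable κ] : #(κ × Finset 𝓑) < boundingNumber := by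
  rw [hbc, Cardinal.mk_prod, Cardinal.lift_id, Cardinal.lift_id]
  exact Cardinal.mul_lt_of_lt Cardinal.aleph0_le_continuum
    (Cardinal.mk_le_aleph0.trans_lt Cardinal.aleph0_lt_continuum) (mk_finset_lt_continuum h𝓑)

theorem exists_mem_contour_notMem_baseFilter (hbc : boundingNumber = 𝔠) {ξ : Ordinal.{0}}
    (h1 : 1 < ξ) (h2 : ξ ≤ ω₁) {𝓑 : Set (Set ℕ)} (h𝓑 : #𝓑 < 𝔠)
    (hne : (baseFilter ξ ⊓ generate 𝓑).NeBot) {W : SeqCascade} (hd : W.DistinctLabels)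
    (hm : W.IsMonotone) (hr : W.rank = ξ) : ∃ U ∈ W.contour, U ∉ baseFilter ξ ⊓ generate 𝓑 := by
  -- As a rank, ξ is countable, so countably many contours of the chain and finite paths in their
  -- cascades are involved.
  have hξ : ξ < ω₁ := hr ▸ W.rank_lt_omega_one
  obtain ⟨e, he⟩ := exists_range_eq_Ico h1 hξ
  have hmem : ∀ j, e j ∈ Ico 1 ξ := fun j => he ▸ mem_range_self j
  let P : (ℕ × List ℕ) × Finset 𝓑 → SeqCascade × Set ℕ :=
    fun i => ((chain (e i.1.1)).sub i.1.2, ⋂ s ∈ i.2, (s : Set ℕ))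
  let Q : ℕ × Finset 𝓑 → SeqCascade × Set ℕ := fun i => (chain (e i.1), ⋂ s ∈ i.2, (s : Set ℕ))
  refine SeqCascade.exists_mem_contour_notMem hd hm (S := range P) (T := range Q)
    (Cardinal.mk_range_le.trans_lt (card_index_lt hbc h𝓑 _)) ?_ ?_ ?_ fun U => ?_
  · rintro V B ⟨⟨⟨j, l⟩, G⟩, h⟩ m
    simp only [P, Prod.mk.injEq] at h
    refine ⟨⟨⟨j, l ++ [m]⟩, G⟩, ?_⟩
    simp only [P, Prod.mk.injEq]
    exact ⟨sub_concat h.1 m, h.2⟩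
  · rintro _ ⟨⟨j, G⟩, rfl⟩
    exact ⟨⟨⟨j, []⟩, G⟩, by simp [P, Q, sub]⟩
  · rintro _ ⟨⟨j, G⟩, rfl⟩
    rw [hr]
    exact (chain_spec (hmem j).1 ((hmem j).2.trans hξ)).2.2.1.trans_lt (hmem j).2
  · rw [mem_inf_generate]
    simp only [mem_inf_principal, mem_baseFilter h1 h2]
    constructor
    · rintro ⟨G, α, hα, h⟩
      obtain ⟨j, rfl⟩ : α ∈ range e := he ▸ hα
      exact ⟨_, ⟨⟨j, G⟩, rfl⟩, h⟩
    · rintro ⟨_, ⟨⟨j, G⟩, rfl⟩, h⟩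
      exact ⟨G, e j, hmem j, h⟩

theorem preimage_unpair_mem_map_pair (F : Filter ℕ) (n : ℕ) :
    (fun x => x.unpair.1) ⁻¹' {n} ∈ map (Nat.pair n) F := by
  rw [mem_map]
  exact univ_mem' fun x => by simp

/-- Countably many members of the base filter come from ranks with a common bound δ < ω₁, so rank δ
+ 1 already collects them. -/
theorem baseFilter_le_bind_omega_one :
    baseFilter ω₁ ≤ Filter.bind cofinite fun n => map (Nat.pair n) (baseFilter ω₁) := by
  have h1 : (1 : Ordinal.{0}) < ω₁ := Ordinal.one_lt_omega0.trans Ordinal.omega0_lt_omega_one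
  intro U hU
  change ∀ᶠ n in cofinite, Nat.pair n ⁻¹' U ∈ baseFilter ω₁ at hU
  simp only [mem_baseFilter h1 le_rfl] at hU
  have : ∀ n, ∃ α ∈ Ico 1 ω₁, (∃ α ∈ Ico 1 ω₁, Nat.pair n ⁻¹' U ∈ (chain α).contour) →
      Nat.pair n ⁻¹' U ∈ (chain α).contour := by
    intro n
    by_cases h : ∃ α ∈ Ico 1 ω₁, Nat.pair n ⁻¹' U ∈ (chain α).contour
    · obtain ⟨α, hα, hmem⟩ := h
      exact ⟨α, hα, fun _ => hmem⟩
    · exact ⟨1, ⟨le_rfl, h1⟩, fun h' => absurd h' h⟩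
  choose γ hγ hmem using this
  have hsup : ⨆ n, γ n < ω₁ := Ordinal.iSup_lt_omega_one fun n => (hγ n).2
  have hle : ∀ n, γ n ≤ ⨆ n, γ n := Ordinal.le_iSup γ
  set δ := ⨆ n, γ n
  have hδ1 : 1 ≤ δ := (hγ 0).1.trans (hle 0)
  have hδ : Order.succ δ < ω₁ := (Cardinal.isSuccLimit_omega 1).succ_lt hsup
  have hlt : 1 < Order.succ δ := Order.lt_succ_iff.2 hδ1
  refine (mem_baseFilter h1 le_rfl).2 ⟨Order.succ δ, ⟨hlt.le, hδ⟩, ?_⟩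
  rw [contour_chain_of_one_lt hlt hδ]
  change ∀ᶠ n in cofinite, _
  obtain ⟨hmono, hmem', hcof⟩ := ladder_spec hlt hδ
  obtain ⟨N, hN⟩ := hcof δ (Order.lt_succ δ)
  have hge : ∀ᶠ n in cofinite, N ≤ n := by
    rw [Nat.cofinite_eq_atTop]; exact eventually_ge_atTop N
  filter_upwards [hU, hge] with n hn hNn
  exact contour_chain_anti (hγ n).1 ((hle n).trans (hN.trans (hmono hNn)))
    ((hmem' n).2.trans hδ) (hmem n hn)

theorem bind_le_baseFilter_omega_one :
    (Filter.bind cofinite fun n => map (Nat.pair n) (baseFilter ω₁)) ≤ baseFilter ω₁ := by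
  have h1 : (1 : Ordinal.{0}) < ω₁ := Ordinal.one_lt_omega0.trans Ordinal.omega0_lt_omega_one
  intro U hU
  obtain ⟨α, hα, hU⟩ := (mem_baseFilter h1 le_rfl).1 hU
  have h2 : 1 < Order.succ α := Order.lt_succ_iff.2 hα.1
  have h3 : Order.succ α < ω₁ := (Cardinal.isSuccLimit_omega 1).succ_lt hα.2
  have hU' := contour_chain_anti hα.1 (Order.le_succ α) h3 hU
  rw [contour_chain_of_one_lt h2 h3] at hU'
  change ∀ᶠ n in cofinite, _ at hU'
  change ∀ᶠ n in cofinite, _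
  filter_upwards [hU'] with n hn
  have := (ladder_spec h2 h3).2.1 n
  exact baseFilter_le this.1 (this.2.trans h3) hn

theorem exists_notMem_compl_notMem_baseFilter (hbc : boundingNumber = 𝔠) {ξ : Ordinal.{0}}
    (h1 : 1 < ξ) (h2 : ξ ≤ ω₁) {𝓑 : Set (Set ℕ)} (h𝓑 : #𝓑 < 𝔠)
    (hne : (baseFilter ξ ⊓ generate 𝓑).NeBot) :
    ∃ A, A ∉ baseFilter ξ ⊓ generate 𝓑 ∧ Aᶜ ∉ baseFilter ξ ⊓ generate 𝓑 := by
  have hgen : ∀ G : Finset 𝓑, generate 𝓑 ≤ 𝓟 (⋂ s ∈ G, (s : Set ℕ)) := fun G =>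
    le_principal_iff.2 ((biInter_finset_mem G).2 fun s _ => mem_generate_of_mem s.2)
  rcases h2.eq_or_lt with rfl | hξ
  -- The chain has ω₁ contours, which may be as many as 𝔟. Writing the base filter as an iteration
  -- of itself leaves only the finite subsets of 𝓑 to index.
  · refine exists_notMem_compl_notMem (card_index_lt hbc h𝓑 Unit)
      (p := fun x => x.unpair.1) (Φ := fun _ n => map (Nat.pair n) (baseFilter ω₁))
      (B := fun i => ⋂ s ∈ i.2, (s : Set ℕ)) (fun _ n => preimage_unpair_mem_map_pair _ n)
      (fun i => hne.mono (inf_le_inf baseFilter_le_bind_omega_one (hgen _))) fun U hU => ?_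
    obtain ⟨G, hG⟩ := mem_inf_generate.1 hU
    exact ⟨⟨(), G⟩, inf_le_inf_right _ bind_le_baseFilter_omega_one hG⟩
  rcases (Order.succ_le_of_lt h1).eq_or_lt with h | h
  -- For ξ = 2 the base filter is the cofinite filter, and points replace columns.
  · refine exists_notMem_compl_notMem (card_index_lt hbc h𝓑 Unit)
      (p := id) (Φ := fun _ n => pure n)
      (B := fun i => ⋂ s ∈ i.2, (s : Set ℕ)) (fun _ n => by simp)
      (fun i => hne.mono (inf_le_inf ?_ (hgen _))) fun U hU => ?_
    · have := baseFilter_le le_rfl h1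
      rwa [chain_one] at this
    · obtain ⟨G, hG⟩ := mem_inf_generate.1 hU
      refine ⟨⟨(), G⟩, ?_⟩
      rw [mem_inf_principal] at hG ⊢
      obtain ⟨α, hα, hG⟩ := (mem_baseFilter h1 h2).1 hG
      rw [← h, mem_Ico, Order.lt_succ_iff] at hα
      rwa [le_antisymm hα.2 hα.1, chain_one] at hG
  -- For 2 < ξ < ω₁ the countably many ranks from 2 on suffice, and their contours all split along
  -- the same columns.
  · obtain ⟨e, he⟩ := exists_range_eq_Ico h hξ
    have hmem : ∀ j, e j ∈ Ico (Order.succ 1) ξ := fun j => he ▸ mem_range_self j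
    have hlt : ∀ j, 1 < e j := fun j => Order.succ_le_iff.1 (hmem j).1
    refine exists_notMem_compl_notMem (card_index_lt hbc h𝓑 ℕ)
      (p := fun x => x.unpair.1)
      (Φ := fun i n => map (Nat.pair n) (chain (ladder (e i.1) n)).contour)
      (B := fun i => ⋂ s ∈ i.2, (s : Set ℕ)) (fun _ n => preimage_unpair_mem_map_pair _ n)
      (fun i => hne.mono (inf_le_inf ?_ (hgen _))) fun U hU => ?_
    · rw [← contour_chain_of_one_lt (hlt _) ((hmem _).2.trans hξ)]
      exact baseFilter_le (hlt _).le (hmem _).2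
    · obtain ⟨G, hG⟩ := mem_inf_generate.1 hU
      rw [mem_inf_principal] at hG
      obtain ⟨α, hα, hG⟩ := (mem_baseFilter h1 h2).1 hG
      obtain ⟨j, hj⟩ : max α (Order.succ 1) ∈ range e := he ▸ ⟨le_max_right _ _, max_lt hα.2 h⟩
      refine ⟨⟨j, G⟩, ?_⟩
      rw [← contour_chain_of_one_lt (hlt _) ((hmem _).2.trans hξ), mem_inf_principal, hj]
      exact contour_chain_anti hα.1 (le_max_left _ _) ((max_lt hα.2 h).trans hξ) hG

/-! ### The transfinite construction -/

/-- The filters obtained at the indices t ∈ I form a chain, so their union is proper. -/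
theorem neBot_inf_biInf_principal {T : Type} [LinearOrder T] {F : Filter ℕ} [F.NeBot]
    {a : T → Set ℕ} {I : Set T}
    (h : ∀ t ∈ I, (F ⊓ (⨅ s ∈ Iio t, 𝓟 (a s)) ⊓ 𝓟 (a t)).NeBot) :
    (F ⊓ ⨅ s ∈ I, 𝓟 (a s)).NeBot := by
  rcases I.eq_empty_or_nonempty with rfl | hI
  · simpa
  have : Nonempty I := hI.to_subtype
  have hne : (⨅ t : I, F ⊓ (⨅ s ∈ Iio (t : T), 𝓟 (a s)) ⊓ 𝓟 (a t)).NeBot := by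
    refine iInf_neBot_of_directed' (Antitone.directed_ge fun t t' htt' => ?_) fun t => h t t.2
    rcases htt'.eq_or_lt with rfl | hlt
    · exact le_rfl
    · refine inf_le_left.trans (le_inf (inf_le_inf_left F ?_) (inf_le_right.trans ?_))
      · exact biInf_mono fun s hs => lt_trans hs hlt
      · exact biInf_le (fun s => 𝓟 (a s)) (show (t : T) ∈ Iio (t' : T) from hlt)
  refine hne.mono (le_inf ?_ (le_iInf₂ fun s hs => ?_))
  · exact (iInf_le _ (Classical.arbitrary I)).trans (inf_le_left.trans inf_le_left)
  · exact (iInf_le _ (⟨s, hs⟩ : I)).trans inf_le_right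

/-- Sets meeting prescribed requirements can be chosen by transfinite recursion, such that at
every index they generate a proper filter together with `F`. -/
theorem exists_transfinite_choice {T : Type} [LinearOrder T] [WellFoundedLT T] {J : Type}
    (F : Filter ℕ) [F.NeBot] (Req : T → (J → Set ℕ) → Prop)
    (step : ∀ t (a : T → J → Set ℕ), (∀ p, (F ⊓ ⨅ s ∈ Iio t, 𝓟 (a s p)).NeBot) →
      ∃ x, Req t x ∧ ∀ p, (F ⊓ (⨅ s ∈ Iio t, 𝓟 (a s p)) ⊓ 𝓟 (x p)).NeBot) :
    ∃ a : T → J → Set ℕ, (∀ t, Req t (a t)) ∧ ∀ p, (F ⊓ ⨅ s, 𝓟 (a s p)).NeBot := by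
  classical
  let a : T → J → Set ℕ := WellFoundedLT.fix fun t rec =>
    if h : ∃ x, Req t x ∧ ∀ p, (F ⊓ (⨅ s, ⨅ hs : s < t, 𝓟 (rec s hs p)) ⊓ 𝓟 (x p)).NeBot
    then h.choose else fun _ => univ
  have ha : ∀ t, (∃ x, Req t x ∧ ∀ p, (F ⊓ (⨅ s ∈ Iio t, 𝓟 (a s p)) ⊓ 𝓟 (x p)).NeBot) →
      Req t (a t) ∧ ∀ p, (F ⊓ (⨅ s ∈ Iio t, 𝓟 (a s p)) ⊓ 𝓟 (a t p)).NeBot := by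
    intro t h
    have heq : a t = h.choose := by
      simp only [a]
      rw [WellFoundedLT.fix_eq]
      exact dif_pos h
    rw [heq]
    exact h.choose_spec
  have hgood : ∀ t, Req t (a t) ∧ ∀ p, (F ⊓ (⨅ s ∈ Iio t, 𝓟 (a s p)) ⊓ 𝓟 (a t p)).NeBot := by
    intro t
    induction t using WellFoundedLT.induction with
    | ind t ih =>
      exact ha t (step t a fun p =>
        neBot_inf_biInf_principal (a := fun s => a s p) fun s hs => (ih s hs).2 p)
  refine ⟨a, fun t => (hgood t).1, fun p => ?_⟩
  have := neBot_inf_biInf_principal (F := F) (a := fun s => a s p) (I := univ)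
    fun s _ => (hgood s).2 p
  simpa using this

theorem neBot_inf_principal_compl {H : Filter ℕ} {U : Set ℕ} (h : U ∉ H) : (H ⊓ 𝓟 Uᶜ).NeBot :=
  ⟨fun h' => h (mem_iff_inf_principal_compl.2 h')⟩

theorem exists_incomparable_ultrafilters {F : Filter ℕ} [F.NeBot] {𝒲 : Set SeqCascade}
    (hW : ∀ 𝓑 : Set (Set ℕ), #𝓑 < 𝔠 → (F ⊓ generate 𝓑).NeBot → ∀ W ∈ 𝒲,
      ∃ U ∈ W.contour, U ∉ F ⊓ generate 𝓑)
    (hA : ∀ 𝓑 : Set (Set ℕ), #𝓑 < 𝔠 → (F ⊓ generate 𝓑).NeBot →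
      ∃ A, A ∉ F ⊓ generate 𝓑 ∧ Aᶜ ∉ F ⊓ generate 𝓑) :
    ∃ u : Set ℕ → Ultrafilter ℕ, (∀ p, ↑(u p) ≤ F) ∧
      (∀ p, ∀ W ∈ 𝒲, ¬ ↑(u p) ≤ W.contour) ∧ ∀ p q, p ≠ q → ¬ RKLE (u p) (u q) := by
  classical
  let J := Set ℕ
  let T := (Cardinal.continuum.{0}).ord.ToType
  -- A task (p, W) keeps the contour of W out of u p; a task (p, q, f) keeps f from mapping u p to u
  -- q.
  let τ := (J × SeqCascade) ⊕ (J × J × (ℕ → ℕ))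
  have hτ : #τ ≤ #T := by
    have : #J = 𝔠 := by simp [J]
    simp only [τ, T, Cardinal.mk_sum, Cardinal.mk_prod, Cardinal.lift_id, Cardinal.mk_ord_toType,
      this]
    refine Cardinal.add_le_of_le Cardinal.aleph0_le_continuum ?_ ?_
    · exact (mul_le_mul' le_rfl SeqCascade.mk_le_continuum).trans (by simp)
    · simp
  have : Nonempty τ := ⟨Sum.inl (∅, SeqCascade.leaf 0)⟩
  obtain ⟨⟨i, hi⟩⟩ := hτ
  let e : T → τ := Function.invFun i
  have he : Function.Surjective e := Function.invFun_surjective hi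
  let Req : T → (J → Set ℕ) → Prop := fun t x =>
    (∀ p W, e t = Sum.inl (p, W) → W ∈ 𝒲 → (x p)ᶜ ∈ W.contour) ∧
    (∀ p q f, e t = Sum.inr (p, q, f) → p ≠ q → Disjoint (x p) (f ⁻¹' x q))
  obtain ⟨a, hReq, hne⟩ := exists_transfinite_choice F Req (by
    intro t a hne
    have hgen : ∀ p, ⨅ s ∈ Iio t, 𝓟 (a s p) = generate ((fun s => a s p) '' Iio t) := by
      intro p
      rw [generate_eq_biInf, iInf_image]
    have hcard : ∀ p, #((fun s => a s p) '' Iio t) < 𝔠 := fun p =>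
      Cardinal.mk_image_le.trans_lt ((Cardinal.mk_Iio_lt t (by simp [T])).trans_eq (by simp [T]))
    simp only [hgen] at hne ⊢
    rcases het : e t with ⟨p, W⟩ | ⟨p, q, f⟩
    · by_cases hWW : W ∈ 𝒲
      · obtain ⟨U, hU, hUn⟩ := hW _ (hcard p) (hne p) W hWW
        refine ⟨Function.update (fun _ => univ) p Uᶜ, ⟨?_, ?_⟩, fun p' => ?_⟩
        · rintro p' W' h' -
          rw [het] at h'
          cases h'
          simpa using hU
        · intro p' q' f' h'
          rw [het] at h'
          cases h'
        · by_cases hp : p' = p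
          · subst hp
            simpa using neBot_inf_principal_compl hUn
          · simpa [hp] using hne p'
      · refine ⟨fun _ => univ, ⟨?_, ?_⟩, fun p' => by simpa using hne p'⟩
        · rintro p' W' h' hW'
          rw [het] at h'
          cases h'
          exact absurd hW' hWW
        · intro p' q' f' h'
          rw [het] at h'
          cases h'
    · by_cases hpq : p = q
      · refine ⟨fun _ => univ, ⟨?_, ?_⟩, fun p' => by simpa using hne p'⟩
        · intro p' W' h'
          rw [het] at h'
          cases h'
        · intro p' q' f' h' hne'
          rw [het] at h'
          cases h'
          exact absurd hpq hne'
      -- For A undecided by the q-th filter, the p-th cannot contain the preimages of both A and its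
      -- complement. Choosing C between the two, C can be added at q and the complement of f⁻¹ C at
      -- p.
      · obtain ⟨C, hC1, hC2⟩ : ∃ C, f ⁻¹' C ∉ F ⊓ generate ((fun s => a s p) '' Iio t) ∧
            Cᶜ ∉ F ⊓ generate ((fun s => a s q) '' Iio t) := by
          obtain ⟨A, hA1, hA2⟩ := hA _ (hcard q) (hne q)
          by_cases h : f ⁻¹' A ∈ F ⊓ generate ((fun s => a s p) '' Iio t)
          · refine ⟨Aᶜ, ?_, by rwa [compl_compl]⟩
            rw [preimage_compl]
            have := hne p
            exact compl_notMem h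
          · exact ⟨A, h, hA2⟩
        refine ⟨Function.update (Function.update (fun _ => univ) p (f ⁻¹' C)ᶜ) q C,
          ⟨?_, ?_⟩, fun p' => ?_⟩
        · intro p' W' h'
          rw [het] at h'
          cases h'
        · intro p' q' f' h' _
          rw [het] at h'
          cases h'
          rw [Function.update_of_ne hpq, Function.update_self, Function.update_self]
          exact disjoint_compl_left
        · by_cases hq : p' = q
          · subst hq
            simpa using neBot_inf_principal_compl hC2
          · rw [Function.update_of_ne hq]
            by_cases hp : p' = p
            · subst hp
              simpa using neBot_inf_principal_compl hC1
            · simpa [hp] using hne p')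
  have hmem : ∀ p t, a t p ∈ @Ultrafilter.of _ _ (hne p) := fun p t =>
    ((@Ultrafilter.of_le _ _ (hne p)).trans (inf_le_right.trans (iInf_le _ t)))
      (mem_principal_self _)
  refine ⟨fun p => @Ultrafilter.of _ _ (hne p),
    fun p => (@Ultrafilter.of_le _ _ (hne p)).trans inf_le_left, fun p W hWW hle => ?_, ?_⟩
  · obtain ⟨t, ht⟩ := he (Sum.inl (p, W))
    exact Ultrafilter.compl_notMem_iff.2 (hmem p t) (hle ((hReq t).1 p W ht hWW))
  · rintro q p hqp ⟨f, hf⟩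
    obtain ⟨t, ht⟩ := he (Sum.inr (p, q, f))
    have h1 : a t q ∈ (@Ultrafilter.of _ _ (hne p)).map f := hf ▸ hmem q t
    obtain ⟨x, hx1, hx2⟩ := Ultrafilter.nonempty_of_mem
      (inter_mem (hmem p t) (Ultrafilter.mem_map.1 h1))
    exact disjoint_left.1 ((hReq t).2 p q f ht hqp.symm) hx1 hx2

/-! ### The family in 𝒫_ξ -/

theorem corollary2p26 (hbc : boundingNumber = 𝔠) (ξ : Ordinal.{0}) (h1 : 1 < ξ) (h2 : ξ ≤ ω₁) :
    ∃ U : Set (Ultrafilter ℕ), U ⊆ PClass ξ ∧ #U = boundingNumber ∧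
      U.Pairwise fun u v => ¬ RKLE u v ∧ ¬ RKLE v u := by
  have := neBot_baseFilter h1 h2
  obtain ⟨u, hle, hcont, hrk⟩ := exists_incomparable_ultrafilters (F := baseFilter ξ)
    (𝒲 := {W | W.DistinctLabels ∧ W.IsMonotone ∧ W.rank = ξ})
    (fun 𝓑 h𝓑 hne W hW =>
      exists_mem_contour_notMem_baseFilter hbc h1 h2 h𝓑 hne hW.1 hW.2.1 hW.2.2)
    (fun 𝓑 h𝓑 hne => exists_notMem_compl_notMem_baseFilter hbc h1 h2 h𝓑 hne)
  have hinj : Function.Injective u := fun p q h => by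
    by_contra hpq
    exact hrk p q hpq ⟨id, by rw [h, Ultrafilter.map_id]⟩
  refine ⟨range u, ?_, ?_, ?_⟩
  · rintro _ ⟨p, rfl⟩
    refine ⟨fun β hβ1 hβ2 => ?_, ?_⟩
    · obtain ⟨hd, hm, hr, -⟩ := chain_spec hβ1 (hβ2.trans_le h2)
      exact ⟨_, ⟨_, hd, hm, hr, rfl⟩, (hle p).trans (baseFilter_le hβ1 hβ2)⟩
    · rintro ⟨_, ⟨W, hd, hm, hr, rfl⟩, h⟩
      exact hcont p W ⟨hd, hm, hr⟩ h
  · rw [Cardinal.mk_range_eq _ hinj, hbc]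
    simp
  · rintro _ ⟨p, rfl⟩ _ ⟨q, rfl⟩ hne
    have hpq : p ≠ q := fun h => hne (h ▸ rfl)
    exact ⟨hrk p q hpq, hrk q p hpq.symm⟩
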